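/- Let $(a_k)_{k\ge 0}$ be a sequence of i.i.d. (possibly complex) random variables with $\mathbb E[\log(1+|a_0|)]<\infty$, and let $F(z)=\sum_{k=0}^\infty a_k z^k$. Then, almost surely, the series converges in the unit disk $\mathbb D=\{z\in\mathbb C:|z|<1\}$ and defines an analytic function there, and $$\mathbb P\big[\exists\,\alpha\in\mathbb D:\ F(\alpha)=F'(\alpha)=0\big]=\mathbb P\big[F(0)=F'(0)=0\big]=\big(\mathbb P[a_0=0]\big)^2 .$$ Moreover, if $\mathbb P[a_0=0]<1$, then almost surely there is no $\alpha\in\mathbb D\setminus\{0\}$ with $F(\alpha)=F'(\alpha)=0$. -/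

import Mathlib

open MeasureTheory ProbabilityTheory

/-- The power series `z ↦ ∑ k, a k * z ^ k` with coefficient sequence `a`. -/
noncomputable def taylorSeries (a : ℕ → ℂ) (z : ℂ) : ℂ := ∑' k : ℕ, a k * z ^ k

/-- `f` has a zero of order at least two at `z`: both `f` and its derivative vanish there. -/
def IsDoubleZero (f : ℂ → ℂ) (z : ℂ) : Prop := f z = 0 ∧ deriv f z = 0

open Filter Topology

/-! Exchanging the coefficients of index k and k + 1 preserves the i.i.d. law and adds d z^k (1 - z)
to F, where d = a_{k+1} - a_k. Fix a compact K in the punctured disk. If F is not identically zero,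
then for large k no such perturbation with 0 < |d| ≤ M has a double zero in K: at one, F would be
exponentially small in k, whereas the two equations allow only polynomial smallness
(`eventually_not_isDoubleZero_add`). So late swaps with 0 < |d| ≤ M leave the event E of a double
zero in K. But E is almost determined by finitely many coefficients, hence almost invariant under
late swaps and almost independent of d. This forces P(E) = 0 (`infinitePi_eq_zero_of_swap`).
Exhausting the punctured disk leaves only the origin, where independence gives the probability. -/

theorem hasFPowerSeriesOnBall_taylorSeries {a : ℕ → ℂ}
    (ha : ∀ z ∈ Metric.ball (0 : ℂ) 1, Summable fun k : ℕ => a k * z ^ k) :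
    HasFPowerSeriesOnBall (taylorSeries a) (FormalMultilinearSeries.ofScalars ℂ a) 0 1 where
  r_le := by
    refine ENNReal.le_of_forall_nnreal_lt fun r hr => ?_
    apply FormalMultilinearSeries.le_radius_of_summable
    have hr' : (r : ℝ) < 1 := by exact_mod_cast hr
    have := (ha (r : ℝ) (by simpa using hr')).norm
    simpa [FormalMultilinearSeries.ofScalars_norm] using this
  r_pos := one_pos
  hasSum := by
    intro y hy
    have hy' : y ∈ Metric.ball (0 : ℂ) 1 := by
      simpa [← ENNReal.ofReal_one, Metric.eball_ofReal] using hy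
    have := (ha y hy').hasSum
    simpa [taylorSeries, FormalMultilinearSeries.ofScalars_apply_eq, mul_comm] using this

theorem analyticOnNhd_taylorSeries {a : ℕ → ℂ}
    (ha : ∀ z ∈ Metric.ball (0 : ℂ) 1, Summable fun k : ℕ => a k * z ^ k) :
    AnalyticOnNhd ℂ (taylorSeries a) (Metric.ball 0 1) := by
  have := (hasFPowerSeriesOnBall_taylorSeries ha).analyticOnNhd
  rwa [← ENNReal.ofReal_one, Metric.eball_ofReal] at this

theorem isDoubleZero_taylorSeries_zero {a : ℕ → ℂ}
    (ha : ∀ z ∈ Metric.ball (0 : ℂ) 1, Summable fun k : ℕ => a k * z ^ k) :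
    IsDoubleZero (taylorSeries a) 0 ↔ a 0 = 0 ∧ a 1 = 0 := by
  have h := (hasFPowerSeriesOnBall_taylorSeries ha).hasFPowerSeriesAt
  have h0 : taylorSeries a 0 = a 0 := by
    rw [taylorSeries, tsum_eq_single 0] <;> simp +contextual
  have h1 : deriv (taylorSeries a) 0 = a 1 := by
    rw [h.deriv]; simp
  rw [IsDoubleZero, h0, h1]

/-- If the power series vanishes near a point of the unit disk, all its coefficients vanish. -/
theorem coeff_eq_zero_of_eventually_taylorSeries_eq_zero {a : ℕ → ℂ}
    (ha : ∀ z ∈ Metric.ball (0 : ℂ) 1, Summable fun k : ℕ => a k * z ^ k) {α : ℂ}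
    (hα : α ∈ Metric.ball (0 : ℂ) 1) (h : ∀ᶠ z in 𝓝 α, taylorSeries a z = 0) : a = 0 := by
  have hE := (analyticOnNhd_taylorSeries ha).eqOn_zero_of_preconnected_of_eventuallyEq_zero
    (convex_ball 0 1).isPreconnected hα h
  have h0 : ∀ᶠ z in 𝓝 (0 : ℂ), taylorSeries a z = 0 :=
    mem_of_superset (Metric.ball_mem_nhds 0 one_pos) hE
  have hp := ((hasFPowerSeriesOnBall_taylorSeries ha).hasFPowerSeriesAt).eq_zero_of_eventually h0
  exact (FormalMultilinearSeries.ofScalars_series_eq_zero ℂ).1 hp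

/-! ### Effect of a coefficient swap on double zeros. -/

theorem summable_comp_swap {a : ℕ → ℂ} {z : ℂ} (h : Summable fun k : ℕ => a k * z ^ k) (k : ℕ) :
    Summable (fun j : ℕ => a (Equiv.swap k (k + 1) j) * z ^ j) ∧
    ∑' j : ℕ, a (Equiv.swap k (k + 1) j) * z ^ j =
      (∑' j : ℕ, a j * z ^ j) + (a (k + 1) - a k) * (z ^ k * (1 - z)) := by
  have hk : HasSum (fun j : ℕ => if j = k then (a (k + 1) - a k) * z ^ k else 0) _ :=
    hasSum_ite_eq k _
  have hk' : HasSum (fun j : ℕ => if j = k + 1 then (a k - a (k + 1)) * z ^ (k + 1) else 0) _ :=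
    hasSum_ite_eq (k + 1) _
  have := (h.hasSum.add hk).add hk'
  have e : (fun j : ℕ => a (Equiv.swap k (k + 1) j) * z ^ j) = fun j : ℕ =>
      a j * z ^ j + (if j = k then (a (k + 1) - a k) * z ^ k else 0)
        + (if j = k + 1 then (a k - a (k + 1)) * z ^ (k + 1) else 0) := by
    funext j
    rcases eq_or_ne j k with rfl | h1
    · simp; ring
    rcases eq_or_ne j (k + 1) with rfl | h2
    · simp; ring
    · simp [h1, h2, Equiv.swap_apply_of_ne_of_ne h1 h2]
  rw [e]
  exact ⟨this.summable, by rw [this.tsum_eq]; ring⟩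

theorem deriv_add_mul_pow_mul_one_sub {F : ℂ → ℂ} {z d : ℂ} (hF : DifferentiableAt ℂ F z) (k : ℕ) :
    deriv (fun w => F w + d * (w ^ k * (1 - w))) z =
      deriv F z + d * (k * z ^ (k - 1) * (1 - z) - z ^ k) := by
  have h1 : HasDerivAt (fun w : ℂ => w ^ k * (1 - w))
      (k * z ^ (k - 1) * (1 - z) + z ^ k * (0 - 1)) z :=
    (hasDerivAt_pow k z).mul ((hasDerivAt_const z (1 : ℂ)).sub (hasDerivAt_id z))
  refine (hF.hasDerivAt.add (h1.const_mul d)).deriv.trans ?_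
  ring

/-- A small perturbation `d z ^ k (1 - z)` with `k` large destroys every double zero near `α`. -/
theorem eventually_not_isDoubleZero_add {F : ℂ → ℂ} {α : ℂ} (hF : AnalyticAt ℂ F α)
    (hne : ¬ ∀ᶠ z in 𝓝 α, F z = 0) (hα0 : α ≠ 0) (hα1 : ‖α‖ < 1) (M : ℝ) :
    ∀ᶠ p : ℕ × ℂ in atTop ×ˢ 𝓝 α, ∀ d : ℂ, d ≠ 0 → ‖d‖ ≤ M →
      ¬ IsDoubleZero (fun w => F w + d * (w ^ p.1 * (1 - w))) p.2 := by
  obtain ⟨m, h, hh, hhα, hFh⟩ := hF.exists_eventuallyEq_pow_smul_nonzero_iff.2 hne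
  obtain ⟨r, hr1, hr2⟩ := exists_between hα1
  have hr0 : 0 < r := (norm_nonneg α).trans_lt hr1
  -- Off α, q = (z - α)^(1 - m) F' z (1 - z) near α; it is continuous at α, with q(α) = m h(α) α (1
  -- - α).
  set q : ℂ → ℂ := fun z => (m * h z + (z - α) * deriv h z) * (z * (1 - z)) with hq
  have hα1' : (1 : ℂ) - α ≠ 0 := by
    intro h0
    rw [← sub_eq_zero.1 h0] at hα1
    simp at hα1
  have hqc : ContinuousAt q α := by
    have := hh.continuousAt
    have := hh.deriv.continuousAt
    fun_prop
  obtain ⟨η, hη0, hη⟩ := exists_between (norm_pos_iff.2 hhα)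
  obtain ⟨H, hH⟩ := exists_gt ‖h α‖
  have hH0 : 0 < H := (norm_nonneg _).trans_lt hH
  -- a lower bound for `q` is only needed when `F` vanishes at `α`
  obtain ⟨L, hL0, hL⟩ : ∃ L : ℝ, 0 < L ∧ (m ≠ 0 → L < ‖q α‖) := by
    by_cases hm : m = 0
    · exact ⟨1, one_pos, fun h => absurd hm h⟩
    · have : 0 < ‖q α‖ := by
        rw [norm_pos_iff]
        simp [hq, hm, hhα, hα0, hα1']
      obtain ⟨L, h1, h2⟩ := exists_between this
      exact ⟨L, h1, fun _ => h2⟩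
  have hLz : ∀ᶠ z in 𝓝 α, m ≠ 0 → L < ‖q z‖ := by
    by_cases hm : m = 0
    · simp [hm]
    · filter_upwards [hqc.norm.eventually (lt_mem_nhds (hL hm))] with z hz _ using hz
  set δ : ℝ := L / (3 * H) with hδ
  have hδ0 : 0 < δ := by positivity
  have hk : ∀ᶠ k : ℕ in atTop, 1 ≤ k ∧ 2 * M * ((k : ℝ) ^ m * r ^ k) < η * δ ^ m := by
    refine (eventually_ge_atTop 1).and ?_
    have := (tendsto_pow_const_mul_const_pow_of_lt_one m hr0.le hr2).const_mul (2 * M)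
    rw [mul_zero] at this
    exact this.eventually (gt_mem_nhds (by positivity))
  have hz : ∀ᶠ z in 𝓝 α, z ≠ 0 ∧ ‖z‖ < r ∧ η < ‖h z‖ ∧ ‖h z‖ < H ∧
      (F =ᶠ[𝓝 z] fun w => (w - α) ^ m * h w) ∧ DifferentiableAt ℂ h z := by
    refine (eventually_ne_nhds hα0).and ((continuous_norm.continuousAt.eventually
      (gt_mem_nhds hr1)).and ((hh.continuousAt.norm.eventually (lt_mem_nhds hη)).and
      ((hh.continuousAt.norm.eventually (gt_mem_nhds hH)).and (hFh.eventually_nhds.and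
      (hh.eventually_analyticAt.mono fun z hz => hz.differentiableAt)))))
  filter_upwards [hk.prod_mk (hz.and hLz)]
  rintro ⟨k, z⟩ ⟨⟨hk1, hk2⟩, ⟨hz0, hzr, hηz, hHz, hFz, hhz⟩, hLz⟩ d hd0 hdM ⟨hz1, hz2⟩
  dsimp only at *
  have hz1' : (1 : ℂ) - z ≠ 0 := by
    intro h0
    rw [← sub_eq_zero.1 h0, norm_one] at hzr
    linarith
  have hFd : HasDerivAt F (m * (z - α) ^ (m - 1) * 1 * h z + (z - α) ^ m * deriv h z) z := by
    refine HasDerivAt.congr_of_eventuallyEq ?_ hFz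
    exact (((hasDerivAt_id z).sub_const α).pow m).mul hhz.hasDerivAt
  rw [deriv_add_mul_pow_mul_one_sub hFd.differentiableAt] at hz2
  have hFe := hFz.eq_of_nhds
  have hF1 : F z = -(d * (z ^ k * (1 - z))) := eq_neg_of_add_eq_zero_left hz1
  have hF0 : F z ≠ 0 := by
    rw [hF1]
    exact neg_ne_zero.2 (mul_ne_zero hd0 (mul_ne_zero (pow_ne_zero _ hz0) hz1'))
  have hs0 : (z - α) ^ m ≠ 0 := fun h0 => hF0 (by rw [hFe, h0, zero_mul])
  have hnorm1 : ‖1 - z‖ ≤ 2 := by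
    have := norm_sub_le (1 : ℂ) z
    rw [norm_one] at this
    linarith
  have hFle : ‖F z‖ ≤ 2 * M * r ^ k := by
    have hM0 : 0 ≤ M := (norm_nonneg d).trans hdM
    rw [hF1, norm_neg, norm_mul, norm_mul, norm_pow]
    calc ‖d‖ * (‖z‖ ^ k * ‖1 - z‖) ≤ M * (r ^ k * 2) := by gcongr
      _ = _ := by ring
  have hlow : δ ^ m ≤ (k : ℝ) ^ m * ‖(z - α) ^ m‖ := by
    rcases eq_or_ne m 0 with hm | hm
    · simp [hm]
    rw [norm_pow, ← mul_pow]
    refine pow_le_pow_left₀ hδ0.le ?_ m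
    -- Eliminating d between the two equations gives z (1 - z) F' = (k (1 - z) - z) F. As q stays
    -- away from 0, |z - α| is at least δ / k.
    have hqz : q z = h z * (z - α) * (k * (1 - z) - z) := by
      apply mul_left_cancel₀ hs0
      have e1 : (z - α) * deriv F z = (z - α) ^ m * (m * h z + (z - α) * deriv h z) := by
        rw [hFd.deriv]
        obtain ⟨n, rfl⟩ := Nat.exists_eq_succ_of_ne_zero hm
        simp only [Nat.succ_eq_add_one, Nat.add_sub_cancel, pow_succ]
        ring
      have e2 : z * deriv F z = -(d * z ^ k * (k * (1 - z) - z)) := by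
        obtain ⟨n, rfl⟩ := Nat.exists_eq_succ_of_ne_zero (by omega : k ≠ 0)
        rw [eq_neg_of_add_eq_zero_left hz2]
        simp only [Nat.succ_eq_add_one, Nat.add_sub_cancel, pow_succ]
        ring
      calc (z - α) ^ m * q z = (z - α) * deriv F z * (z * (1 - z)) := by rw [e1, hq]; ring
        _ = (z - α) * (1 - z) * (z * deriv F z) := by ring
        _ = F z * (z - α) * (k * (1 - z) - z) := by rw [e2, hF1]; ring
        _ = _ := by rw [hFe]; ring
    have h3 : ‖(k : ℂ) * (1 - z) - z‖ ≤ 3 * k := by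
      have hk1' : (1 : ℝ) ≤ k := by exact_mod_cast hk1
      calc ‖(k : ℂ) * (1 - z) - z‖ ≤ ‖(k : ℂ) * (1 - z)‖ + ‖z‖ := norm_sub_le _ _
        _ ≤ k * 2 + 1 := by
          rw [norm_mul, Complex.norm_natCast]
          gcongr
          linarith
        _ ≤ 3 * k := by linarith
    have h4 : L ≤ H * ‖z - α‖ * (3 * k) := by
      refine (hLz hm).le.trans ?_
      rw [hqz, norm_mul, norm_mul]
      gcongr
    rw [hδ, div_le_iff₀ (by positivity)]
    linarith
  have : η * δ ^ m ≤ 2 * M * ((k : ℝ) ^ m * r ^ k) := by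
    calc η * δ ^ m ≤ ‖h z‖ * ((k : ℝ) ^ m * ‖(z - α) ^ m‖) := by gcongr
      _ = (k : ℝ) ^ m * ‖F z‖ := by rw [hFe, norm_mul]; ring
      _ ≤ (k : ℝ) ^ m * (2 * M * r ^ k) := by gcongr
      _ = _ := by ring
  linarith

/-- Exchanging two consecutive, distinct coefficients of large index, with bounded difference,
destroys all double zeros in a compact subset of the punctured disk. -/
theorem eventually_not_isDoubleZero_comp_swap {a : ℕ → ℂ}
    (ha : ∀ z ∈ Metric.ball (0 : ℂ) 1, Summable fun k : ℕ => a k * z ^ k) {K : Set ℂ}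
    (hK : IsCompact K) (hK1 : K ⊆ Metric.ball 0 1) (hK0 : (0 : ℂ) ∉ K) (M : ℝ) :
    ∀ᶠ k : ℕ in atTop, a (k + 1) ≠ a k → ‖a (k + 1) - a k‖ ≤ M →
      ∀ z ∈ K, ¬ IsDoubleZero (taylorSeries (a ∘ Equiv.swap k (k + 1))) z := by
  rcases eq_or_ne a 0 with rfl | ha0
  · simp
  have key : ∀ᶠ k : ℕ in atTop, ∀ z ∈ K, ∀ d : ℂ, d ≠ 0 → ‖d‖ ≤ M →
      ¬ IsDoubleZero (fun w => taylorSeries a w + d * (w ^ k * (1 - w))) z := by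
    refine hK.induction_on (p := fun s => ∀ᶠ k : ℕ in atTop, ∀ z ∈ s, ∀ d : ℂ, d ≠ 0 → ‖d‖ ≤ M →
      ¬ IsDoubleZero (fun w => taylorSeries a w + d * (w ^ k * (1 - w))) z) (by simp)
      (fun s t hst ht => ht.mono fun k hk z hz => hk z (hst hz))
      (fun s t hs ht => (hs.and ht).mono fun k hk z hz => hz.elim (hk.1 z) (hk.2 z)) ?_
    intro α hα
    have hα1 : ‖α‖ < 1 := by simpa using hK1 hα
    have h := eventually_not_isDoubleZero_add (analyticOnNhd_taylorSeries ha α (hK1 hα))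
      (fun h => ha0 (coeff_eq_zero_of_eventually_taylorSeries_eq_zero ha (hK1 hα) h))
      (fun h => hK0 (h ▸ hα)) hα1 M
    obtain ⟨p, hp, q, hq, hpq⟩ := eventually_prod_iff.1 h
    exact ⟨{z | q z}, mem_nhdsWithin_of_mem_nhds hq, hp.mono fun k hk z hz => hpq hk hz⟩
  filter_upwards [key] with k hk hne hM z hz
  have he : taylorSeries (a ∘ Equiv.swap k (k + 1)) =ᶠ[𝓝 z]
      fun w => taylorSeries a w + (a (k + 1) - a k) * (w ^ k * (1 - w)) := by
    filter_upwards [Metric.isOpen_ball.mem_nhds (hK1 hz)] with w hw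
    exact (summable_comp_swap (ha w hw) k).2
  have := hk z hz _ (sub_ne_zero.2 hne) hM
  rwa [IsDoubleZero, he.eq_of_nhds, he.deriv_eq]

/-! ### Measurability of the existence of zeros. -/

/-- The existence of a zero in `K` of a random continuous function is a null-measurable event. -/
theorem nullMeasurableSet_exists_eq_zero {X : Type*} [MeasurableSpace X] {ν : Measure X}
    {K : Set ℂ} (hK : IsCompact K) {f : X → ℂ → ℝ} (hf0 : ∀ x z, 0 ≤ f x z)
    (hfc : ∀ᵐ x ∂ν, ContinuousOn (f x) K) (hfm : ∀ z ∈ K, AEMeasurable (fun x => f x z) ν) :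
    NullMeasurableSet {x | ∃ z ∈ K, f x z = 0} ν := by
  obtain ⟨D, hDc, hDd⟩ := TopologicalSpace.exists_countable_dense K
  -- A continuous nonnegative function attains its minimum on K, so it has a zero iff its infimum
  -- over a countable dense set is 0.
  have hm : NullMeasurableSet {x | ∀ n : ℕ, ∃ z ∈ D, f x z < 1 / ((n : ℝ) + 1)} ν := by
    simp only [Set.ofPred_forall, ← exists_prop, Set.ofPred_exists]
    refine NullMeasurableSet.iInter fun n => NullMeasurableSet.biUnion hDc fun z _ => ?_
    exact nullMeasurableSet_lt (hfm z z.2) aemeasurable_const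
  refine hm.congr ?_
  filter_upwards [hfc] with x hx
  refine propext ⟨fun h => ?_, ?_⟩
  · have hne : K.Nonempty := by
      obtain ⟨z, -, -⟩ := h 0
      exact ⟨z, z.2⟩
    obtain ⟨z, hz, hmin⟩ := hK.exists_isMinOn hne hx
    refine ⟨z, hz, le_antisymm (le_of_forall_pos_lt_add fun ε hε => ?_) (hf0 x z)⟩
    obtain ⟨n, hn⟩ := exists_nat_one_div_lt hε
    obtain ⟨w, -, hw⟩ := h n
    have : f x z ≤ f x w := hmin w.2
    linarith
  · rintro ⟨z, hz, hfz⟩ n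
    have ho : IsOpen {w : K | f x w < 1 / ((n : ℝ) + 1)} :=
      isOpen_lt (continuousOn_iff_continuous_domRestrict.1 hx) continuous_const
    have hn : (0 : ℝ) < 1 / ((n : ℝ) + 1) := by positivity
    obtain ⟨w, hw, hwD⟩ := hDd.inter_open_nonempty _ ho ⟨⟨z, hz⟩, by simpa [hfz] using hn⟩
    exact ⟨w, hwD, hw⟩

/-! ### A zero criterion from swaps in product measures. -/

section Product

variable {β : Type*} [MeasurableSpace β]

theorem measurePreserving_comp_perm_infinitePi (μ : Measure β) [IsProbabilityMeasure μ] (σ : Equiv.Perm ℕ) :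
    MeasurePreserving (fun a : ℕ → β => a ∘ σ)
      (Measure.infinitePi fun _ => μ) (Measure.infinitePi fun _ => μ) where
  measurable := by
    refine measurable_pi_lambda _ fun i => ?_
    exact measurable_pi_apply (σ i)
  map_eq := Measure.map_infinitePi_infinitePi_of_inj (P := fun _ : ℕ => μ) σ.injective

theorem infinitePi_cylinder_inter_pair (μ : Measure β) [IsProbabilityMeasure μ] {s : Finset ℕ}
    {S : Set (s → β)} (hS : MeasurableSet S) {G : Set (β × β)} (hG : MeasurableSet G) {i j : ℕ}
    (hij : i ≠ j) (hi : i ∉ s) (hj : j ∉ s) :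
    Measure.infinitePi (fun _ => μ) (cylinder s S ∩ {a | (a i, a j) ∈ G}) =
      Measure.infinitePi (fun _ => μ) (cylinder s S) * μ.prod μ G := by
  have hind := (iIndepFun_infinitePi (P := fun _ : ℕ => μ) (X := fun _ x => x)
    (fun _ => measurable_id)).indepFun_finset s {i, j} (by simp [hi, hj]) (by fun_prop)
  have hT : MeasurableSet {p : ({i, j} : Finset ℕ) → β |
      (p ⟨i, by simp⟩, p ⟨j, by simp⟩) ∈ G} :=
    ((measurable_pi_apply _).prodMk (measurable_pi_apply _)) hG
  have h := hind.measure_inter_preimage_eq_mul _ _ hS hT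
  rw [← Measure.infinitePi_map_eval_prod (P := fun _ : ℕ => μ) hij,
    Measure.map_apply (by fun_prop) hG]
  exact h

/-- If exchanging the coordinates `k` and `k + 1` with values in `G` eventually leads out of `E`,
and `G` has positive probability, then `E` is a null set. -/
theorem infinitePi_eq_zero_of_swap (μ : Measure β) [IsProbabilityMeasure μ] {E : Set (ℕ → β)}
    (hE : MeasurableSet E) {G : Set (β × β)} (hG : MeasurableSet G) (hG0 : μ.prod μ G ≠ 0)
    (h : ∀ a ∈ E, ∀ᶠ k : ℕ in atTop, (a k, a (k + 1)) ∈ G → a ∘ Equiv.swap k (k + 1) ∉ E) :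
    Measure.infinitePi (fun _ => μ) E = 0 := by
  set ν := Measure.infinitePi fun _ : ℕ => μ with hν
  set T : ℕ → (ℕ → β) → (ℕ → β) := fun k a => a ∘ Equiv.swap k (k + 1) with hT
  have hTp : ∀ k, MeasurePreserving (T k) ν ν := fun k => measurePreserving_comp_perm_infinitePi μ _
  -- By `h`, each sequence lies in only finitely many `B k`, so their measures tend to 0.
  set B : ℕ → Set (ℕ → β) := fun k => {a | (a k, a (k + 1)) ∈ G} ∩ E ∩ T k ⁻¹' E with hB
  have hB0 : Tendsto (fun k => ν (B k)) atTop (𝓝 0) := by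
    rw [← measure_empty (μ := ν)]
    refine tendsto_measure_of_tendsto_indicator_of_isFiniteMeasure atTop ν (fun k => ?_) ?_
    · refine MeasurableSet.inter (MeasurableSet.inter ?_ hE) ((hTp k).measurable hE)
      exact ((measurable_pi_apply k).prodMk (measurable_pi_apply (k + 1))) hG
    · intro a
      by_cases ha : a ∈ E
      · filter_upwards [h a ha] with k hk
        simp only [Set.mem_empty_iff_false, iff_false]
        rintro ⟨⟨h1, -⟩, h2⟩
        exact hk h1 h2
      · exact Eventually.of_forall fun k => by simp [hB, ha]
  have key : ∀ ε : ENNReal, 0 < ε → ν E * μ.prod μ G ≤ ε + ε + ε := by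
    intro ε hε
    obtain ⟨A, hA, hAE⟩ := exists_measure_symmDiff_lt_of_generateFrom_isSetRing (μ := ν)
      (isSetRing_measurableCylinders (α := fun _ : ℕ => β))
      ⟨{Set.univ}, Set.countable_singleton _, 
        Set.singleton_subset_iff.2 (univ_mem_measurableCylinders _), by simp⟩
      generateFrom_measurableCylinders.symm hE hε
    obtain ⟨s, S, hS, rfl⟩ := (mem_measurableCylinders A).1 hA
    set A : Set (ℕ → β) := cylinder (α := fun _ => β) s S with hAdef
    have hAm : MeasurableSet A := hS.cylinder s
    have h1 : ν (A \ E) ≤ ε := (measure_mono (fun x hx => Or.inl hx)).trans hAE.le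
    have h2 : ν (E \ A) ≤ ε := (measure_mono (fun x hx => Or.inr hx)).trans hAE.le
    obtain ⟨n, hn⟩ : ∃ n, ∀ i ∈ s, i < n := ⟨s.sup id + 1, fun i hi =>
      Nat.lt_succ_of_le (Finset.le_sup (f := id) hi)⟩
    have hlim : Tendsto (fun k => ν (B k) + ε + ε + ε) atTop (𝓝 (0 + ε + ε + ε)) :=
      ((hB0.add_const ε).add_const ε).add_const ε
    rw [zero_add] at hlim
    refine ge_of_tendsto hlim ?_
    filter_upwards [eventually_ge_atTop n] with k hk
    have hks : k ∉ s := fun hks => by have := hn k hks; omega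
    have hks' : k + 1 ∉ s := fun hks => by have := hn _ hks; omega
    have hTA : ∀ a, T k a ∈ A ↔ a ∈ A := by
      intro a
      have : s.restrict (T k a) = s.restrict a := by
        funext i
        have h1 : (i : ℕ) ≠ k := fun h => hks (h ▸ i.2)
        have h2 : (i : ℕ) ≠ k + 1 := fun h => hks' (h ▸ i.2)
        simp [hT, Equiv.swap_apply_of_ne_of_ne h1 h2]
      rw [hAdef, mem_cylinder, mem_cylinder, this]
    -- `A` ignores the coordinates k and k + 1, so both a and its swap lie in `A`; outside `B k`,
    -- one of them is in the approximation error.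
    have hsub : A ∩ {a | (a k, a (k + 1)) ∈ G} ⊆ B k ∪ A \ E ∪ T k ⁻¹' (A \ E) := by
      rintro a ⟨haA, haG⟩
      by_cases h1 : a ∈ E
      · by_cases h2 : T k a ∈ E
        · exact Or.inl (Or.inl ⟨⟨haG, h1⟩, h2⟩)
        · exact Or.inr ⟨(hTA a).2 haA, h2⟩
      · exact Or.inl (Or.inr ⟨haA, h1⟩)
    have h3 : ν A * μ.prod μ G ≤ ν (B k) + ε + ε := by
      rw [← infinitePi_cylinder_inter_pair μ hS hG (Nat.succ_ne_self k).symm hks hks']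
      refine (measure_mono hsub).trans ((measure_union_le _ _).trans ?_)
      refine add_le_add ((measure_union_le _ _).trans (add_le_add le_rfl h1)) ?_
      rwa [(hTp k).measure_preimage (hAm.diff hE).nullMeasurableSet]
    calc ν E * μ.prod μ G ≤ (ν A + ε) * μ.prod μ G := by
          gcongr
          refine (measure_mono (fun x hx => ?_ : E ⊆ A ∪ E \ A)).trans
            ((measure_union_le _ _).trans (add_le_add le_rfl h2))
          by_cases hxA : x ∈ A
          · exact Or.inl hxA
          · exact Or.inr ⟨hx, hxA⟩
      _ = ν A * μ.prod μ G + ε * μ.prod μ G := add_mul _ _ _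
      _ ≤ ν (B k) + ε + ε + ε * 1 := by gcongr; exact prob_le_one
      _ = _ := by rw [mul_one]
  have h0 : ν E * μ.prod μ G ≤ 0 := by
    have hlim : Tendsto (fun ε : ENNReal => ε + ε + ε) (𝓝[>] 0) (𝓝 (0 + 0 + 0)) :=
      ((tendsto_id.add tendsto_id).add tendsto_id).mono_left nhdsWithin_le_nhds
    simp only [add_zero] at hlim
    exact ge_of_tendsto hlim (eventually_mem_nhdsWithin.mono fun ε hε => key ε hε)
  exact (mul_eq_zero.1 (nonpos_iff_eq_zero.1 h0)).resolve_right hG0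

end Product

/-- Borel–Cantelli: integrability of the logarithm gives, for each m, eventually 1 + |a_k| ≤ exp(k /
(m + 1)). Letting m grow, the radius of convergence is at least 1. -/
theorem ae_summable_mul_pow {μ : Measure ℂ} [IsProbabilityMeasure μ]
    (hμ : Integrable (fun x => Real.log (1 + ‖x‖)) μ) :
    ∀ᵐ a ∂(Measure.infinitePi fun _ : ℕ => μ),
      ∀ z ∈ Metric.ball (0 : ℂ) 1, Summable fun k : ℕ => a k * z ^ k := by
  have h1 : ∀ m : ℕ, ∀ᵐ a ∂(Measure.infinitePi fun _ : ℕ => μ), ∀ᶠ k : ℕ in atTop,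
      ¬ ((k : ℝ) < (m + 1) * Real.log (1 + ‖a k‖)) := by
    intro m
    refine ae_eventually_notMem
      (s := fun k : ℕ => {a : ℕ → ℂ | (k : ℝ) < (m + 1) * Real.log (1 + ‖a k‖)}) ?_
    have hlt := @tsum_prob_mem_Ioi_lt_top ℂ ⟨μ⟩ ‹_›
      (fun x => ((m : ℝ) + 1) * Real.log (1 + ‖x‖)) (hμ.const_mul _)
      (fun x => mul_nonneg (by positivity) (Real.log_nonneg (by simp)))
    refine ne_of_lt (lt_of_eq_of_lt (tsum_congr fun k => ?_) hlt)
    refine (measurePreserving_eval_infinitePi (fun _ : ℕ => μ) k).measure_preimage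
      (s := {x : ℂ | (k : ℝ) < (m + 1) * Real.log (1 + ‖x‖)}) ?_
    exact (measurableSet_lt measurable_const (by fun_prop)).nullMeasurableSet
  filter_upwards [ae_all_iff.2 h1] with a ha z hz
  rw [mem_ball_zero_iff] at hz
  obtain ⟨m, hm⟩ : ∃ m : ℕ, Real.exp (1 / ((m : ℝ) + 1)) * ‖z‖ < 1 := by
    have : Tendsto (fun m : ℕ => Real.exp (1 / ((m : ℝ) + 1)) * ‖z‖) atTop
        (𝓝 (Real.exp 0 * ‖z‖)) :=
      ((Real.continuous_exp.tendsto 0).comp tendsto_one_div_add_atTop_nhds_zero_nat).mul_const _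
    rw [Real.exp_zero, one_mul] at this
    exact (this.eventually (gt_mem_nhds hz)).exists
  refine Summable.of_norm_bounded_eventually_nat
    (summable_geometric_of_lt_one (by positivity) hm) ?_
  filter_upwards [ha m] with k hk
  rw [norm_mul, norm_pow, mul_pow, ← Real.exp_nat_mul]
  gcongr
  have h2 : Real.log (1 + ‖a k‖) ≤ k * (1 / ((m : ℝ) + 1)) := by
    rw [mul_one_div, le_div_iff₀ (by positivity)]
    linarith [not_lt.1 hk]
  have h3 := (Real.log_le_iff_le_exp (by positivity)).1 h2
  linarith

/-! ### Measurability of the double-zero event. -/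

section Measurability

variable {ν : Measure (ℕ → ℂ)}

theorem aemeasurable_taylorSeries
    (hν : ∀ᵐ a ∂ν, ∀ z ∈ Metric.ball (0 : ℂ) 1, Summable fun k : ℕ => a k * z ^ k)
    {z : ℂ} (hz : z ∈ Metric.ball (0 : ℂ) 1) : AEMeasurable (fun a => taylorSeries a z) ν := by
  refine aemeasurable_of_tendsto_metrizable_ae atTop
    (f := fun n a => ∑ k ∈ Finset.range n, a k * z ^ k)
    (fun n => Measurable.aemeasurable (by fun_prop)) ?_
  filter_upwards [hν] with a ha
  exact (ha z hz).hasSum.tendsto_sum_nat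

theorem aemeasurable_deriv_taylorSeries
    (hν : ∀ᵐ a ∂ν, ∀ z ∈ Metric.ball (0 : ℂ) 1, Summable fun k : ℕ => a k * z ^ k)
    {z : ℂ} (hz : z ∈ Metric.ball (0 : ℂ) 1) :
    AEMeasurable (fun a => deriv (taylorSeries a) z) ν := by
  have hz1 : 0 < 1 - ‖z‖ := by simpa using hz
  -- Steps for difference quotients; n + 2 keeps z + c n strictly inside the disk even at n = 0.
  set c : ℕ → ℂ := fun n => ((1 - ‖z‖ : ℝ) : ℂ) * (((1 : ℝ) / ((n : ℝ) + 2) : ℝ) : ℂ) with hc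
  have hc0 : ∀ n, c n ≠ 0 := fun n => by
    refine mul_ne_zero (Complex.ofReal_ne_zero.2 hz1.ne') (Complex.ofReal_ne_zero.2 ?_)
    positivity
  have hcb : ∀ n, z + c n ∈ Metric.ball (0 : ℂ) 1 := fun n => by
    have h1 : ‖c n‖ < 1 - ‖z‖ := by
      rw [hc, norm_mul, Complex.norm_real, Complex.norm_real, Real.norm_of_nonneg hz1.le,
        Real.norm_of_nonneg (by positivity)]
      refine mul_lt_of_lt_one_right hz1 ?_
      rw [div_lt_one (by positivity)]
      have : (0 : ℝ) ≤ n := n.cast_nonneg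
      linarith
    rw [mem_ball_zero_iff]
    linarith [norm_add_le z (c n)]
  have hclim : Tendsto c atTop (𝓝[≠] 0) := by
    refine tendsto_nhdsWithin_iff.2 ⟨?_, Eventually.of_forall hc0⟩
    have h1 : Tendsto (fun n : ℕ => (1 : ℝ) / ((n : ℝ) + 2)) atTop (𝓝 0) :=
      tendsto_const_nhds.div_atTop (tendsto_natCast_atTop_atTop.atTop_add tendsto_const_nhds)
    have h2 := ((Complex.continuous_ofReal.tendsto 0).comp h1).const_mul ((1 - ‖z‖ : ℝ) : ℂ)
    rw [Complex.ofReal_zero, mul_zero] at h2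
    exact h2
  refine aemeasurable_of_tendsto_metrizable_ae atTop
    (f := fun n a => (c n)⁻¹ • (taylorSeries a (z + c n) - taylorSeries a z)) (fun n => ?_) ?_
  · simp_rw [smul_eq_mul]
    exact ((aemeasurable_taylorSeries hν (hcb n)).sub
      (aemeasurable_taylorSeries hν hz)).const_mul _
  · filter_upwards [hν] with a ha
    exact ((analyticOnNhd_taylorSeries ha z hz).differentiableAt.hasDerivAt.tendsto_slope_zero).comp
      hclim

theorem nullMeasurableSet_exists_isDoubleZero
    (hν : ∀ᵐ a ∂ν, ∀ z ∈ Metric.ball (0 : ℂ) 1, Summable fun k : ℕ => a k * z ^ k)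
    {K : Set ℂ} (hK : IsCompact K) (hK1 : K ⊆ Metric.ball 0 1) :
    NullMeasurableSet {a | ∃ z ∈ K, IsDoubleZero (taylorSeries a) z} ν := by
  have h := nullMeasurableSet_exists_eq_zero (ν := ν) hK
    (f := fun a z => ‖taylorSeries a z‖ + ‖deriv (taylorSeries a) z‖) (fun a z => by positivity)
    (by
      filter_upwards [hν] with a ha
      have hF := analyticOnNhd_taylorSeries ha
      exact (hF.continuousOn.mono hK1).norm.add (hF.deriv.continuousOn.mono hK1).norm)
    (fun z hz => (aemeasurable_taylorSeries hν (hK1 hz)).norm.add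
      (aemeasurable_deriv_taylorSeries hν (hK1 hz)).norm)
  convert h using 5 with a z
  rw [IsDoubleZero, add_eq_zero_iff_of_nonneg (norm_nonneg _) (norm_nonneg _), norm_eq_zero,
    norm_eq_zero]

end Measurability

/-! ### Absence of double zeros off the origin. -/

theorem infinitePi_exists_isDoubleZero_eq_zero {μ : Measure ℂ} [IsProbabilityMeasure μ]
    (hμ : Integrable (fun x => Real.log (1 + ‖x‖)) μ)
    (hne : μ.prod μ {p | p.2 ≠ p.1} ≠ 0) {K : Set ℂ} (hK : IsCompact K)
    (hK1 : K ⊆ Metric.ball 0 1) (hK0 : (0 : ℂ) ∉ K) :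
    Measure.infinitePi (fun _ : ℕ => μ) {a | ∃ z ∈ K, IsDoubleZero (taylorSeries a) z} = 0 := by
  obtain ⟨M, hM⟩ : ∃ M : ℕ, μ.prod μ {p | p.2 ≠ p.1 ∧ ‖p.2 - p.1‖ ≤ M} ≠ 0 := by
    by_contra! hcon
    refine hne (measure_mono_null (fun p hp => ?_) (measure_iUnion_null hcon))
    obtain ⟨M, hM⟩ := exists_nat_ge ‖p.2 - p.1‖
    exact Set.mem_iUnion.2 ⟨M, hp, hM⟩
  have hG : MeasurableSet {p : ℂ × ℂ | p.2 ≠ p.1 ∧ ‖p.2 - p.1‖ ≤ M} :=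
    (measurableSet_eq_fun measurable_snd measurable_fst).compl.inter
      (measurableSet_le (measurable_snd.sub measurable_fst).norm measurable_const)
  have hs := ae_summable_mul_pow hμ
  have hEn : NullMeasurableSet ({a | ∃ z ∈ K, IsDoubleZero (taylorSeries a) z} ∩
      {a | ∀ z ∈ Metric.ball (0 : ℂ) 1, Summable fun k : ℕ => a k * z ^ k})
      (Measure.infinitePi fun _ : ℕ => μ) := by
    refine (nullMeasurableSet_exists_isDoubleZero hs hK hK1).congr ?_
    filter_upwards [hs] with a ha
    exact propext ⟨fun h => ⟨h, ha⟩, fun h => h.1⟩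
  -- A measurable subset suffices: a swap that leaves the full event also leaves `E`.
  obtain ⟨E, hE, hEm, hEe⟩ := hEn.exists_measurable_subset_ae_eq
  have h0 := infinitePi_eq_zero_of_swap μ hEm hG hM fun a haE => by
    filter_upwards [eventually_not_isDoubleZero_comp_swap (hE haE).2 hK hK1 hK0 M]
      with k hk hka hmem
    obtain ⟨⟨z, hz, hz2⟩, -⟩ := hE hmem
    exact hk hka.1 hka.2 z hz hz2
  have h1 := (measure_congr hEe).symm.trans h0
  refine measure_mono_null (t := _ ∪ {a | ¬ ∀ z ∈ Metric.ball (0 : ℂ) 1,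
    Summable fun k : ℕ => a k * z ^ k}) (fun a ha => ?_) (measure_union_null h1 hs)
  by_cases h : ∀ z ∈ Metric.ball (0 : ℂ) 1, Summable fun k : ℕ => a k * z ^ k
  · exact Or.inl ⟨ha, h⟩
  · exact Or.inr h

theorem ae_forall_not_isDoubleZero {μ : Measure ℂ} [IsProbabilityMeasure μ]
    (hμ : Integrable (fun x => Real.log (1 + ‖x‖)) μ) (h0 : μ {0} < 1) :
    ∀ᵐ a ∂(Measure.infinitePi fun _ : ℕ => μ), ∀ z ∈ Metric.ball (0 : ℂ) 1, z ≠ 0 →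
      ¬ IsDoubleZero (taylorSeries a) z := by
  -- If the law is degenerate, no swap changes anything; but then F = a_0 / (1 - z) with a_0 ≠ 0,
  -- which has no zero.
  by_cases hne : μ.prod μ {p | p.2 ≠ p.1} = 0
  · have h1 : ∀ k : ℕ, ∀ᵐ a ∂(Measure.infinitePi fun _ : ℕ => μ), a (k + 1) = a k := by
      intro k
      rw [← Measure.infinitePi_map_eval_prod (P := fun _ : ℕ => μ) (Nat.succ_ne_self k).symm] at hne
      exact ae_of_ae_map (p := fun p : ℂ × ℂ => p.2 = p.1) (by fun_prop) hne
    have hz : μ {0} = 0 := by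
      have h2 : μ.prod μ ({0} ×ˢ {0}ᶜ) = 0 := measure_mono_null (by
        rintro ⟨x, y⟩ ⟨hx, hy⟩ hxy
        exact hy (hxy.trans hx)) hne
      rw [Measure.prod_prod] at h2
      refine (mul_eq_zero.1 h2).resolve_right fun h3 => h0.ne ?_
      exact (prob_compl_eq_zero_iff (measurableSet_singleton 0)).1 h3
    have h2 : ∀ᵐ a ∂(Measure.infinitePi fun _ : ℕ => μ), a 0 ≠ 0 := by
      have h3 := (measurePreserving_eval_infinitePi (fun _ : ℕ => μ) 0).measure_preimage
        (s := {0}) (measurableSet_singleton 0).nullMeasurableSet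
      rw [hz] at h3
      exact measure_eq_zero_iff_ae_notMem.1 h3
    filter_upwards [ae_all_iff.2 h1, h2] with a ha ha0 z hz _ hd
    have hconst : ∀ k, a k = a 0 := fun k => by
      induction k with
      | zero => rfl
      | succ k ih => rw [ha k, ih]
    have hz1 : ‖z‖ < 1 := by simpa using hz
    have hsum : taylorSeries a z = a 0 * (1 - z)⁻¹ := by
      simp_rw [taylorSeries, hconst, tsum_mul_left, tsum_geometric_of_norm_lt_one hz1]
    have h1z : (1 : ℂ) - z ≠ 0 := fun h => by
      rw [← sub_eq_zero.1 h, norm_one] at hz1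
      exact lt_irrefl _ hz1
    exact mul_ne_zero ha0 (inv_ne_zero h1z) (hsum.symm.trans hd.1)
  · set K : ℕ → Set ℂ := fun n =>
      Metric.closedBall 0 (1 - 1 / ((n : ℝ) + 1)) \ Metric.ball 0 (1 / ((n : ℝ) + 1)) with hKdef
    have hpos : ∀ n : ℕ, (0 : ℝ) < 1 / ((n : ℝ) + 1) := fun n => by positivity
    have hK : ∀ n, ∀ᵐ a ∂(Measure.infinitePi fun _ : ℕ => μ),
        ¬ ∃ z ∈ K n, IsDoubleZero (taylorSeries a) z := fun n =>
      measure_eq_zero_iff_ae_notMem.1 <| infinitePi_exists_isDoubleZero_eq_zero hμ hne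
        ((isCompact_closedBall 0 _).diff Metric.isOpen_ball)
        (fun z hz => Metric.closedBall_subset_ball (by linarith [hpos n]) hz.1)
        (fun h => h.2 (Metric.mem_ball_self (hpos n)))
    filter_upwards [ae_all_iff.2 hK] with a ha z hz hz0 hd
    rw [mem_ball_zero_iff] at hz
    obtain ⟨n, hn⟩ := exists_nat_one_div_lt (lt_min (sub_pos.2 hz) (norm_pos_iff.2 hz0))
    rw [lt_min_iff] at hn
    refine ha n ⟨z, ⟨?_, ?_⟩, hd⟩
    · rw [mem_closedBall_zero_iff]
      linarith [hn.1]
    · rw [mem_ball_zero_iff]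
      exact not_lt.2 hn.2.le

theorem theorem1p3 {Ω : Type*} [MeasurableSpace Ω] (P : Measure Ω) [IsProbabilityMeasure P]
    (a : ℕ → Ω → ℂ) (ha_meas : ∀ k, Measurable (a k)) (ha_indep : iIndepFun a P)
    (ha_ident : ∀ k, IdentDistrib (a k) (a 0) P P)
    (ha_log : Integrable (fun ω => Real.log (1 + ‖a 0 ω‖)) P) :
    -- almost surely the series converges in the unit disk and defines an analytic function there
    (∀ᵐ ω ∂P, (∀ z ∈ Metric.ball (0 : ℂ) 1, Summable (fun k : ℕ => a k ω * z ^ k)) ∧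
      AnalyticOnNhd ℂ (taylorSeries (fun k => a k ω)) (Metric.ball 0 1)) ∧
    P {ω | ∃ α ∈ Metric.ball (0 : ℂ) 1, IsDoubleZero (taylorSeries (fun k => a k ω)) α} =
      P {ω | IsDoubleZero (taylorSeries (fun k => a k ω)) 0} ∧
    P {ω | IsDoubleZero (taylorSeries (fun k => a k ω)) 0} = P {ω | a 0 ω = 0} ^ 2 ∧
    -- unless the series vanishes identically, there is almost surely no double zero off the origin
    (P {ω | a 0 ω = 0} < 1 → ∀ᵐ ω ∂P, ∀ α ∈ Metric.ball (0 : ℂ) 1, α ≠ 0 →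
      ¬ IsDoubleZero (taylorSeries (fun k => a k ω)) α) := by
  set μ := P.map (a 0) with hμ
  have : IsProbabilityMeasure μ := Measure.isProbabilityMeasure_map (ha_meas 0).aemeasurable
  have hmeas : Measurable fun ω k => a k ω := measurable_pi_lambda _ ha_meas
  have hlaw : P.map (fun ω k => a k ω) = Measure.infinitePi fun _ : ℕ => μ := by
    rw [ha_indep.map_fun_eq_infinitePi_map ha_meas]
    simp_rw [fun k => (ha_ident k).map_eq]
    rfl
  have hμlog : Integrable (fun x => Real.log (1 + ‖x‖)) μ :=
    (integrable_map_measure (Measurable.aestronglyMeasurable (by fun_prop))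
      (ha_meas 0).aemeasurable).2 ha_log
  have hμ0 : μ {0} = P {ω | a 0 ω = 0} :=
    Measure.map_apply (ha_meas 0) (measurableSet_singleton 0)
  have hsum : ∀ᵐ ω ∂P, ∀ z ∈ Metric.ball (0 : ℂ) 1, Summable fun k : ℕ => a k ω * z ^ k := by
    refine ae_of_ae_map (f := fun ω k => a k ω) (p := fun b : ℕ → ℂ => ∀ z ∈ Metric.ball (0 : ℂ) 1,
      Summable fun k : ℕ => b k * z ^ k) hmeas.aemeasurable ?_
    rw [hlaw]
    exact ae_summable_mul_pow hμlog
  have hno : P {ω | a 0 ω = 0} < 1 → ∀ᵐ ω ∂P, ∀ α ∈ Metric.ball (0 : ℂ) 1, α ≠ 0 →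
      ¬ IsDoubleZero (taylorSeries (fun k => a k ω)) α := by
    intro hlt
    refine ae_of_ae_map (f := fun ω k => a k ω) (p := fun b : ℕ → ℂ => ∀ z ∈ Metric.ball (0 : ℂ) 1,
      z ≠ 0 → ¬ IsDoubleZero (taylorSeries b) z) hmeas.aemeasurable ?_
    rw [hlaw]
    exact ae_forall_not_isDoubleZero hμlog (hμ0 ▸ hlt)
  have hzero : P {ω | IsDoubleZero (taylorSeries (fun k => a k ω)) 0} = P {ω | a 0 ω = 0} ^ 2 := by
    have h1 : P {ω | IsDoubleZero (taylorSeries (fun k => a k ω)) 0} =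
        P (a 0 ⁻¹' {0} ∩ a 1 ⁻¹' {0}) := by
      refine measure_congr ?_
      filter_upwards [hsum] with ω hω
      exact propext (isDoubleZero_taylorSeries_zero hω)
    rw [h1, (ha_indep.indepFun zero_ne_one).measure_inter_preimage_eq_mul _ _
      (measurableSet_singleton 0) (measurableSet_singleton 0),
      (ha_ident 1).measure_mem_eq (measurableSet_singleton 0), sq]
    rfl
  refine ⟨hsum.mono fun ω hω => ⟨hω, analyticOnNhd_taylorSeries hω⟩, ?_, hzero, hno⟩
  have hle : P {ω | IsDoubleZero (taylorSeries (fun k => a k ω)) 0} ≤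
      P {ω | ∃ α ∈ Metric.ball (0 : ℂ) 1, IsDoubleZero (taylorSeries (fun k => a k ω)) α} :=
    measure_mono fun ω hω => ⟨0, Metric.mem_ball_self one_pos, hω⟩
  refine le_antisymm ?_ hle
  -- If a_0 = 0 almost surely, the origin alone already has probability 1.
  rcases eq_or_ne (P {ω | a 0 ω = 0}) 1 with h1 | h1
  · rw [hzero, h1, one_pow]
    exact prob_le_one
  · refine measure_mono_ae ?_
    filter_upwards [hno (lt_of_le_of_ne prob_le_one h1)] with ω hω
    rintro ⟨α, hα, hd⟩
    rcases eq_or_ne α 0 with rfl | h0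
    · exact hd
    · exact absurd hd (hω α hα h0)
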